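/- Let $N$ be a positive integer, $\alpha\in\mathbb{Z}/N\mathbb{Z}$, and let $\mathcal{P}(N;\alpha)$ be the set of prime numbers $p$ with $p\equiv\alpha \pmod N$. For a commutative ring $R$ put $$\mathcal{A}_{n}:=\Bigl(\prod_{p\in\mathcal{P}(N;\alpha)}R/p^{n}R\Bigr)\Big/\Bigl(\bigoplus_{p\in\mathcal{P}(N;\alpha)}R/p^{n}R\Bigr)\quad(n\ge 1),\qquad \widehat{\mathcal{A}}^{\mathcal{P}(N;\alpha)}_{R}:=\varprojlim_{n}\mathcal{A}_{n},$$ with the projective limit topology, each $\mathcal{A}_n$ being discrete; this is a $\mathbb{Q}$-algebra. Let $\pi\colon\prod_{p}\varprojlim_{n}R/p^{n}R\to\widehat{\mathcal{A}}^{\mathcal{P}(N;\alpha)}_{R}$ be the natural projection, and put $\boldsymbol{p}:=\pi((p)_{p})$ and $a^{\boldsymbol{p}}:=\pi((a^{p})_{p})$ for $a\in R$. For $a_1,\dots,a_m\in R$ and positive integers $k_1,\dots,k_m$ define the $\boldsymbol{p}$-adic finite multiple polylogarithm $$\pounds_{\widehat{\mathcal{A}},\alpha}\binom{a_1,\dots,a_m}{k_1,\dots,k_m}:=\pi\Biggl(\Bigl(\sum_{0<n_1<\cdots<n_m<p}\frac{a_1^{n_1}a_2^{n_2-n_1}\cdots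 a_m^{n_m-n_{m-1}}}{n_1^{k_1}\cdots n_m^{k_m}}\Bigr)_{p\in\mathcal{P}(N;\alpha)}\Biggr)\in\widehat{\mathcal{A}}^{\mathcal{P}(N;\alpha)}_{R}.$$ Let $r\ge 0$, $s\ge 1$, let $x_1,\dots,x_r,y_1,\dots,y_s$ be indeterminates, $k_1,\dots,k_r,l_1,\dots,l_s$ positive integers, and $R=\mathbb{Z}[x_1,\dots,x_r,y_1,y_1^{-1},y_2,\dots,y_s]$. On the $\mathbb{Q}$-vector space with basis the formal tuples $\binom{a_1,\dots,a_m}{h_1,\dots,h_m}$ ($m\ge 0$, $a_i\in\{1,x_1,\dots,x_r,y_1,\dots,y_s\}$, $h_i\ge 1$), let $\sqcup\!\sqcup$ be the product obtained by identifying such a tuple with the word $e_{a_1}e_0^{h_1-1}\cdots e_{a_m}e_0^{h_m-1}$ in the noncommutative polynomial ring over $\mathbb{Q}$ in the letters $e_z$, $z\in\{0,1,x_1,\dots,x_r,y_1,\dots,y_s\}$, and taking the shuffle product of words (the $\mathbb{Q}$-bilinear product with $1\,\sqcup\!\sqcup\,w=w\,\sqcup\!\sqcup\,1=w$ and $we_z\,\sqcup\!\sqcup\,w'e_{z'}=(we_z\,\sqcup\!\sqcup\,w')e_{z'}+(w\,\sqcup\!\sqcup\,w'e_{z'})e_z$).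 Extend $\pounds_{\widehat{\mathcal{A}},\alpha}$ $\mathbb{Q}$-linearly to this space. Then the series below converges (unconditionally) and $$\pounds_{\widehat{\mathcal{A}},\alpha}\left(\binom{x_1,\dots,x_r}{k_1,\dots,k_r}\,\sqcup\!\sqcup\,\binom{y_1,\dots,y_s}{l_1,\dots,l_s}\right)=(-1)^{l_1+\cdots+l_s}\,y_1^{\boldsymbol{p}}\sum_{f_1,\dots,f_s\ge 0}\left(\prod_{i=1}^{s}\binom{l_i+f_i-1}{f_i}\right)\pounds_{\widehat{\mathcal{A}},\alpha}\binom{x_1/y_1,\dots,x_r/y_1,\,1/y_1,\,y_s/y_1,\dots,y_2/y_1}{k_1,\dots,k_r,\,l_s+f_s,\dots,l_1+f_1}\,\boldsymbol{p}^{f_1+\cdots+f_s}$$ holds in $\widehat{\mathcal{A}}^{\mathcal{P}(N;\alpha)}_{R}$. (The factors $\binom{l_i+f_i-1}{f_i}$ in the product are binomial coefficients.) -/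

import Mathlib

/-! ### Tuples, words and the shuffle product

`A` is the set of nonzero letters; the letters are `Option A`, with `none` playing the role of the
letter `0`. -/

namespace PShuffle

/-- The noncommutative polynomial ring `ℚ⟨e_z | z ∈ {0} ∪ A⟩`. -/
abbrev Words (A : Type*) := FreeAlgebra ℚ (Option A)

/-- The letter `e_z`. -/
abbrev e {A : Type*} (z : Option A) : Words A := FreeAlgebra.ι ℚ z

/-- The basis of `Words A` consisting of the words. -/
noncomputable def wordBasis (A : Type*) : Module.Basis (List (Option A)) ℚ (Words A) :=
  FreeAlgebra.basisFreeMonoid ℚ (Option A)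

theorem wordBasis_apply {A : Type*} (u : List (Option A)) :
    wordBasis A u = (u.map e).prod := by
  change (FreeAlgebra.equivMonoidAlgebraFreeMonoid (R := ℚ) (X := Option A)).symm
    (MonoidAlgebra.single (FreeMonoid.ofList u) 1) = _
  rw [AlgEquiv.symm_apply_eq, map_list_prod, List.map_map]
  induction u with
  | nil => simp [MonoidAlgebra.one_def]
  | cons a u ih =>
    rw [List.map_cons, List.prod_cons, ← ih]
    simp [FreeAlgebra.equivMonoidAlgebraFreeMonoid, MonoidAlgebra.single_mul_single]

/-- Shuffle product of two words, each written from its last letter to its first one. -/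
noncomputable def shuffleRev {A : Type*} : List (Option A) → List (Option A) → Words A
  | [], v => (v.reverse.map e).prod
  | z :: u, [] => ((z :: u).reverse.map e).prod
  | z :: u, z' :: v => shuffleRev (z :: u) v * e z' + shuffleRev u (z' :: v) * e z
termination_by u v => u.length + v.length

/-- The `ℚ`-bilinear shuffle product on `Words A`. -/
noncomputable def shuffle {A : Type*} : Words A →ₗ[ℚ] Words A →ₗ[ℚ] Words A :=
  (wordBasis A).constr ℚ fun u => (wordBasis A).constr ℚ fun v => shuffleRev u.reverse v.reverse

/-- The `ℚ`-vector space spanned by the tuples `(a₁, …, a_r; k₁, …, k_r)` with `a_i ∈ A` and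
`k_i` positive integers. -/
abbrev Tuples (A : Type*) := List (A × ℕ+) →₀ ℚ

/-- The linear injection `W` that sends `(a₁, …, a_r; k₁, …, k_r)` to
`e_{a₁} e₀^{k₁-1} ⋯ e_{a_r} e₀^{k_r-1}`. -/
noncomputable def W {A : Type*} : Tuples A →ₗ[ℚ] Words A :=
  Finsupp.linearCombination ℚ fun t : List (A × ℕ+) =>
    (t.map fun c => e (some c.1) * e none ^ ((c.2 : ℕ) - 1)).prod

/-- Reads a word from the right; the first entry counts the pending letters `e₀`. -/
def decodeAux {A : Type*} : List (Option A) → ℕ × List (A × ℕ+)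
  | [] => (0, [])
  | none :: u => ((decodeAux u).1 + 1, (decodeAux u).2)
  | some a :: u => (0, (a, (decodeAux u).1.succPNat) :: (decodeAux u).2)

/-- The inverse of `W` on the span of the words that are empty or do not begin with `e₀`. -/
noncomputable def WInv {A : Type*} : Words A →ₗ[ℚ] Tuples A :=
  (wordBasis A).constr ℚ fun u => Finsupp.single (decodeAux u).2 1

/-- The shuffle product of tuples, `W⁻¹ (W a ⧢ W b)`. -/
noncomputable def tupleShuffle {A : Type*} (a b : Tuples A) : Tuples A :=
  WInv (shuffle (W a) (W b))

/-! The next facts, up to `W_tupleShuffle`, show that `tupleShuffle` is well defined: `WInv` is a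
left inverse of `W`, and `W` carries `tupleShuffle` to `shuffle`. -/

/-- The word of a tuple, as a list of letters. -/
def encode {A : Type*} (t : List (A × ℕ+)) : List (Option A) :=
  t.flatMap fun c => some c.1 :: List.replicate ((c.2 : ℕ) - 1) none

theorem W_single {A : Type*} (t : List (A × ℕ+)) :
    W (Finsupp.single t 1) = wordBasis A (encode t) := by
  rw [wordBasis_apply, W, Finsupp.linearCombination_single, one_smul]
  induction t with
  | nil => simp [encode]
  | cons c t ih => simp_all [encode, mul_assoc]

theorem decodeAux_replicate {A : Type*} (n : ℕ) (u : List (Option A)) :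
    decodeAux (List.replicate n none ++ u) = ((decodeAux u).1 + n, (decodeAux u).2) := by
  induction n with
  | zero => simp
  | succ n ih => simp [List.replicate_succ, decodeAux, ih, add_assoc]

theorem decodeAux_encode {A : Type*} (t : List (A × ℕ+)) : decodeAux (encode t) = (0, t) := by
  induction t with
  | nil => simp [encode, decodeAux]
  | cons c t ih =>
    have : encode (c :: t) = some c.1 :: (List.replicate ((c.2 : ℕ) - 1) none ++ encode t) := by
      simp [encode]
    rw [this, decodeAux, decodeAux_replicate, ih]
    have h : ((c.2 : ℕ) - 1).succPNat = c.2 := PNat.eq (Nat.sub_add_cancel c.2.pos)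
    simp [h]

theorem encode_decodeAux {A : Type*} (u : List (Option A)) :
    List.replicate (decodeAux u).1 none ++ encode (decodeAux u).2 = u := by
  induction u with
  | nil => simp [encode, decodeAux]
  | cons z u ih =>
    cases z with
    | none => simpa [decodeAux, List.replicate_succ] using ih
    | some a => simpa [decodeAux, encode] using ih

theorem encode_decodeAux_of_head {A : Type*} (u : List (Option A)) (h : u.head? ≠ some none) :
    encode (decodeAux u).2 = u := by
  have := encode_decodeAux u
  match u, h with
  | [], _ => rfl
  | some a :: u, _ => simpa [decodeAux] using this

theorem WInv_W {A : Type*} (a : Tuples A) : WInv (W a) = a := by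
  induction a using Finsupp.induction_linear with
  | zero => simp
  | add f g hf hg => simp [hf, hg]
  | single t c =>
    rw [← mul_one c, ← smul_eq_mul, ← Finsupp.smul_single, map_smul, map_smul, W_single, WInv,
      Module.Basis.constr_basis, decodeAux_encode]

theorem shuffle_basis {A : Type*} (u v : List (Option A)) :
    shuffle (wordBasis A u) (wordBasis A v) = shuffleRev u.reverse v.reverse := by
  simp [shuffle]

theorem shuffleRev_mem {A : Type*} : ∀ u v : List (Option A),
    u.reverse.head? ≠ some none → v.reverse.head? ≠ some none →
    shuffleRev u v ∈ Submodule.span ℚ (wordBasis A ''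
      {w | w.head? ≠ some none ∧ w.length = u.length + v.length})
  | [], v, _, hv => by
    rw [shuffleRev, ← wordBasis_apply]
    exact Submodule.subset_span ⟨_, ⟨hv, by simp⟩, rfl⟩
  | z :: u, [], hu, _ => by
    rw [shuffleRev, ← wordBasis_apply]
    exact Submodule.subset_span ⟨_, ⟨hu, by simp⟩, rfl⟩
  | z :: u, z' :: v, hu, hv => by
    have tail : ∀ (x : Option A) (w : List (Option A)),
        (x :: w).reverse.head? ≠ some none → w.reverse.head? ≠ some none := by
      intro x w h h'
      apply h
      rw [List.reverse_cons, List.head?_append, h']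
      rfl
    have step : ∀ (x : Option A) (n : ℕ) (W : Words A),
        W ∈ Submodule.span ℚ (wordBasis A '' {w | w.head? ≠ some none ∧ w.length = n + 1}) →
        W * e x ∈ Submodule.span ℚ
          (wordBasis A '' {w | w.head? ≠ some none ∧ w.length = n + 2}) := by
      intro x n W hW
      induction hW using Submodule.span_induction with
      | zero => simp
      | add a b _ _ ha hb => rw [add_mul]; exact Submodule.add_mem _ ha hb
      | smul c a _ ha => rw [smul_mul_assoc]; exact Submodule.smul_mem _ _ ha
      | mem a ha =>
        obtain ⟨w, ⟨h1, h2⟩, rfl⟩ := ha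
        refine Submodule.subset_span ⟨w ++ [x], ⟨?_, by simp [h2]⟩, ?_⟩
        · cases w with
          | nil => simp at h2
          | cons b w => simpa using h1
        · simp [wordBasis_apply]
    rw [shuffleRev]
    have e1 : (z :: u).length + (z' :: v).length = (u.length + v.length) + 2 := by
      simp; omega
    rw [e1]
    refine Submodule.add_mem _ (step _ _ _ ?_) (step _ _ _ ?_)
    · have := shuffleRev_mem (z :: u) v hu (tail _ _ hv)
      rwa [show (z :: u).length + v.length = u.length + v.length + 1 by simp; omega] at this
    · have := shuffleRev_mem u (z' :: v) (tail _ _ hu) hv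
      rwa [show u.length + (z' :: v).length = u.length + v.length + 1 by simp; omega] at this
termination_by u v => u.length + v.length

theorem W_WInv_basis {A : Type*} (u : List (Option A)) (h : u.head? ≠ some none) :
    W (WInv (wordBasis A u)) = wordBasis A u := by
  rw [WInv, Module.Basis.constr_basis, W_single, encode_decodeAux_of_head u h]

theorem encode_head {A : Type*} (t : List (A × ℕ+)) : (encode t).head? ≠ some none := by
  cases t <;> simp [encode]

theorem W_tupleShuffle {A : Type*} (a b : Tuples A) :
    W (tupleShuffle a b) = shuffle (W a) (W b) := by
  have lin : (LinearMap.compr₂ (shuffle.compl₁₂ W W) (W ∘ₗ WInv) :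
      Tuples A →ₗ[ℚ] Tuples A →ₗ[ℚ] Words A) = shuffle.compl₁₂ W W := by
    refine Finsupp.lhom_ext' fun t => LinearMap.ext_ring ?_
    refine Finsupp.lhom_ext' fun t' => LinearMap.ext_ring ?_
    simp only [LinearMap.comp_apply, Finsupp.lsingle_apply, LinearMap.compr₂_apply,
      LinearMap.compl₁₂_apply, W_single, shuffle_basis]
    have := shuffleRev_mem (encode t).reverse (encode t').reverse
      (by simpa using encode_head t) (by simpa using encode_head t')
    refine LinearMap.eqOn_span (f := W ∘ₗ WInv) (g := LinearMap.id) ?_ this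
    rintro _ ⟨w, hw, rfl⟩
    exact W_WInv_basis w hw.1
  exact LinearMap.congr_fun₂ lin a b

/-! The defining recursion of the shuffle product. -/

theorem one_shuffle {A : Type*} (w : Words A) : shuffle 1 w = w := by
  have h1 : (1 : Words A) = wordBasis A [] := by simp [wordBasis_apply]
  have : shuffle (1 : Words A) = LinearMap.id := by
    refine (wordBasis A).ext fun u => ?_
    rw [h1, shuffle_basis, List.reverse_nil, shuffleRev, List.reverse_reverse,
      ← wordBasis_apply, LinearMap.id_apply]
  rw [this, LinearMap.id_apply]

theorem shuffle_one {A : Type*} (w : Words A) : shuffle w 1 = w := by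
  have h1 : (1 : Words A) = wordBasis A [] := by simp [wordBasis_apply]
  have : shuffle.flip (1 : Words A) = LinearMap.id := by
    refine (wordBasis A).ext fun u => ?_
    rw [h1, LinearMap.flip_apply, shuffle_basis, LinearMap.id_apply, List.reverse_nil,
      wordBasis_apply]
    conv_rhs => rw [← List.reverse_reverse u]
    cases u.reverse <;> rw [shuffleRev]
  exact LinearMap.congr_fun this w

theorem shuffle_mul_letter {A : Type*} (w w' : Words A) (z z' : Option A) :
    shuffle (w * e z) (w' * e z') =
      shuffle (w * e z) w' * e z' + shuffle w (w' * e z') * e z := by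
  have snoc : ∀ (u : List (Option A)) (x : Option A),
      LinearMap.mulRight ℚ (e x) (wordBasis A u) = wordBasis A (u ++ [x]) := by
    intro u x
    simp [wordBasis_apply]
  have lin : (shuffle.compl₁₂ (LinearMap.mulRight ℚ (e z)) (LinearMap.mulRight ℚ (e z')) :
      Words A →ₗ[ℚ] Words A →ₗ[ℚ] Words A) =
      (shuffle.compl₁₂ (LinearMap.mulRight ℚ (e z)) LinearMap.id).compr₂
        (LinearMap.mulRight ℚ (e z')) +
      (shuffle.compl₁₂ LinearMap.id (LinearMap.mulRight ℚ (e z'))).compr₂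
        (LinearMap.mulRight ℚ (e z)) := by
    refine (wordBasis A).ext fun u => (wordBasis A).ext fun v => ?_
    simp only [LinearMap.add_apply, LinearMap.compr₂_apply, LinearMap.compl₁₂_apply, snoc,
      LinearMap.id_apply, shuffle_basis, List.reverse_append, List.reverse_singleton,
      List.singleton_append, LinearMap.mulRight_apply]
    rw [shuffleRev]
  exact LinearMap.congr_fun₂ lin w w'

/-! ### The adelic ring -/

section Adelic

variable {ι R : Type*} [CommRing R] (σ : ι → R)

/-- The ideal `⨁ R/aⁿR` of `∏ R/aⁿR`, where `a` runs through the family `σ`. -/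
def finSuppIdeal (n : ℕ) : Ideal (∀ i, R ⧸ Ideal.span {σ i} ^ n) where
  carrier := {f | {i | f i ≠ 0}.Finite}
  zero_mem' := by simp
  add_mem' {f g} hf hg := (Set.Finite.union hf hg).subset fun i hi => by
    by_contra h
    simp only [Set.mem_union, Set.mem_ofPred_eq, not_or, not_not] at h
    exact hi (by simp [h.1, h.2])
  smul_mem' c f hf := Set.Finite.subset hf fun i hi h => hi (by simp [h])

/-- `𝒜ₙ = (∏ R/aⁿR) / (⨁ R/aⁿR)`. -/
abbrev AdelicLevel (n : ℕ) := (∀ i, R ⧸ Ideal.span {σ i} ^ n) ⧸ finSuppIdeal σ n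

/-- The natural projection `∏ R/aⁿR → ∏ R/aᵐR`. -/
def piTransition {m n : ℕ} (h : m ≤ n) :
    (∀ i, R ⧸ Ideal.span {σ i} ^ n) →+* (∀ i, R ⧸ Ideal.span {σ i} ^ m) :=
  RingHom.pi fun i => (Ideal.Quotient.factorPow (Ideal.span {σ i}) h).comp (Pi.evalRingHom _ i)

theorem finSuppIdeal_le_comap {m n : ℕ} (h : m ≤ n) :
    finSuppIdeal σ n ≤ (finSuppIdeal σ m).comap (piTransition σ h) := fun f hf =>
  Set.Finite.subset hf fun i hi h0 => hi (by
    change Ideal.Quotient.factorPow (Ideal.span {σ i}) h (f i) = 0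
    rw [h0, map_zero])

/-- The natural projection `𝒜ₙ → 𝒜ₘ`. -/
def adelicTransition {m n : ℕ} (h : m ≤ n) : AdelicLevel σ n →+* AdelicLevel σ m :=
  Ideal.quotientMap _ (piTransition σ h) (finSuppIdeal_le_comap σ h)

/-- The compatible sequences in `∏_{n ≥ 1} 𝒜ₙ`. -/
def adelicSubring : Subring (∀ n : ℕ+, AdelicLevel σ n) where
  carrier := {f | ∀ m n : ℕ+, ∀ h : m ≤ n,
    adelicTransition σ (PNat.coe_le_coe m n |>.2 h) (f n) = f m}
  mul_mem' hf hg m n h := by simp [hf m n h, hg m n h]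
  one_mem' m n h := by simp
  add_mem' hf hg m n h := by simp [hf m n h, hg m n h]
  zero_mem' m n h := by simp
  neg_mem' hf m n h := by simp [hf m n h]

/-- The adelic ring `𝒜̂ = lim 𝒜ₙ`. -/
def Adelic : Type _ := adelicSubring σ

noncomputable instance : CommRing (Adelic σ) := inferInstanceAs (CommRing (adelicSubring σ))

/-- The projective limit topology, each `𝒜ₙ` being discrete. -/
instance : TopologicalSpace (Adelic σ) :=
  TopologicalSpace.induced (fun f : Adelic σ => f.1)
    (@Pi.topologicalSpace ℕ+ (fun n => AdelicLevel σ n) fun _ => ⊥)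

/-- The natural projection `π : ∏ lim R/aⁿR → 𝒜̂`. -/
noncomputable def adelicProj :
    (∀ i, AdicCompletion (Ideal.span {σ i}) R) →+* Adelic σ :=
  RingHom.codRestrict
    (RingHom.pi fun n : ℕ+ => (Ideal.Quotient.mk (finSuppIdeal σ n)).comp
      (RingHom.pi fun i => ((AdicCompletion.evalₐ (Ideal.span {σ i}) n).toRingHom).comp
        (Pi.evalRingHom _ i)))
    (adelicSubring σ) fun f m n h => by
      refine congrArg (Ideal.Quotient.mk (finSuppIdeal σ m)) (funext fun i => ?_)
      change Ideal.Quotient.factorPow _ (PNat.coe_le_coe m n |>.2 h)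
        (AdicCompletion.evalₐ (Ideal.span {σ i}) n (f i)) = AdicCompletion.evalₐ _ m (f i)
      induction f i using AdicCompletion.induction_on with
      | h c =>
        rw [AdicCompletion.evalₐ_mk, AdicCompletion.evalₐ_mk, Ideal.Quotient.factor_mk]
        have hc := c.property (PNat.coe_le_coe m n |>.2 h)
        rw [SModEq.sub_mem] at hc
        rw [Ideal.Quotient.eq, ← neg_sub, neg_mem_iff]
        simpa using hc

end Adelic

/-! ### Finite multiple polylogarithms -/

/-- `∑_{m < n₁ < ⋯ < n_r < M} a₁^{n₁-m} a₂^{n₂-n₁} ⋯ a_r^{n_r-n_{r-1}} / (n₁^{k₁} ⋯ n_r^{k_r})`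
in a commutative ring in which `1, …, M - 1` are invertible. -/
noncomputable def mplFrom {S : Type*} [CommRing S] (M : ℕ) : ℕ → List (S × ℕ) → S
  | _, [] => 1
  | m, (a, k) :: t =>
      ∑ n ∈ Finset.Ioo m M, a ^ (n - m) * Ring.inverse ((n : S) ^ k) * mplFrom M n t

/-- `£_{<M}(a₁, …, a_r; k₁, …, k_r) = ∑_{0 < n₁ < ⋯ < n_r < M}
a₁^{n₁} a₂^{n₂-n₁} ⋯ a_r^{n_r-n_{r-1}} / (n₁^{k₁} ⋯ n_r^{k_r})`. -/
noncomputable def mplTrunc {S : Type*} [CommRing S] (M : ℕ) (t : List (S × ℕ)) : S :=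
  mplFrom M 0 t

/-- The primes congruent to `α` modulo `N`. -/
abbrev PrimesMod (N : ℕ) (α : ZMod N) := {p : ℕ // p.Prime ∧ (p : ZMod N) = α}

section FMPL

variable (N : ℕ) (α : ZMod N) (R : Type*) [CommRing R]

/-- The adelic ring of `R` for the family of the primes congruent to `α` modulo `N`. -/
abbrev AHat := Adelic (fun p : PrimesMod N α => ((p : ℕ) : R))

theorem isUnit_intCast_level (m : ℤ) (hm : m ≠ 0) (n : ℕ) :
    IsUnit (m : AdelicLevel (fun p : PrimesMod N α => ((p : ℕ) : R)) n) := by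
  have key : ∀ p : PrimesMod N α, ¬ ((p : ℕ) : ℤ) ∣ m →
      IsUnit (m : R ⧸ Ideal.span {((p : ℕ) : R)} ^ n) := by
    intro p hp
    have hc : IsCoprime m (((p : ℕ) : ℤ) ^ n) :=
      (((Nat.prime_iff_prime_int.1 p.2.1).coprime_iff_not_dvd.2 hp).symm).pow_right
    obtain ⟨a, b, hab⟩ := hc
    refine IsUnit.of_mul_eq_one (a : R ⧸ Ideal.span {((p : ℕ) : R)} ^ n) ?_
    have h0 : (((p : ℕ) : R ⧸ Ideal.span {((p : ℕ) : R)} ^ n)) ^ n = 0 := by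
      rw [← map_natCast (Ideal.Quotient.mk (Ideal.span {((p : ℕ) : R)} ^ n)), ← map_pow,
        Ideal.Quotient.eq_zero_iff_mem]
      exact Ideal.pow_mem_pow (Ideal.mem_span_singleton_self _) n
    have := congrArg (Int.cast : ℤ → R ⧸ Ideal.span {((p : ℕ) : R)} ^ n) hab
    push_cast at this
    rw [h0] at this
    rw [mul_comm]
    simpa using this
  refine IsUnit.of_mul_eq_one (Ideal.Quotient.mk _ fun p => Ring.inverse (m : R ⧸ _)) ?_
  rw [← map_intCast (Ideal.Quotient.mk (finSuppIdeal _ n)), ← map_mul,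
    ← map_one (Ideal.Quotient.mk (finSuppIdeal _ n)), Ideal.Quotient.eq]
  have hfin : {p : PrimesMod N α | ((p : ℕ) : ℤ) ∣ m}.Finite := by
    refine Set.Finite.of_finite_image (f := fun p : PrimesMod N α => (p : ℕ))
      ((Set.finite_le_nat m.natAbs).subset ?_) Subtype.val_injective.injOn
    rintro _ ⟨p, hp, rfl⟩
    exact Nat.le_of_dvd (Int.natAbs_pos.2 hm) (Int.natCast_dvd.1 hp)
  refine hfin.subset fun p hp => ?_
  by_contra h
  refine hp ?_
  change (m : R ⧸ Ideal.span {((p : ℕ) : R)} ^ n) * Ring.inverse (m : R ⧸ _) - 1 = 0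
  rw [Ring.mul_inverse_cancel _ (key p h), sub_self]

theorem isUnit_intCast_AHat (m : ℤ) (hm : m ≠ 0) : IsUnit (m : AHat N α R) := by
  have hu := fun n : ℕ+ => isUnit_intCast_level N α R m hm n
  choose u hu using fun n : ℕ+ => (hu n).exists_right_inv
  refine IsUnit.of_mul_eq_one (⟨u, fun a b h => ?_⟩ : adelicSubring _) ?_
  · have h1 := congrArg (adelicTransition _ (PNat.coe_le_coe a b |>.2 h)) (hu b)
    rw [map_mul, map_intCast, map_one] at h1
    calc _ = (m * u a) * adelicTransition _ (PNat.coe_le_coe a b |>.2 h) (u b) := by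
          rw [hu a, one_mul]
      _ = u a * (m * adelicTransition _ (PNat.coe_le_coe a b |>.2 h) (u b)) := by ring
      _ = u a := by rw [h1, mul_one]
  · exact Subtype.ext (funext fun n => hu n)

/-- `AHat N α R` is a `ℚ`-algebra. -/
noncomputable instance : Algebra ℚ (AHat N α R) :=
  (IsLocalization.lift (M := nonZeroDivisors ℤ) (S := ℚ) (g := Int.castRingHom (AHat N α R))
    fun m => isUnit_intCast_AHat N α R m (nonZeroDivisors.ne_zero m.2)).toAlgebra

/-- The infinitely large prime `𝐩`, the class of `(p)_p`. -/
noncomputable def bigP : AHat N α R := adelicProj _ fun p => ((p : ℕ) : AdicCompletion _ R)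

variable {R}

/-- The power `a^𝐩`, the class of `(a^p)_p`. -/
noncomputable def powP (a : R) : AHat N α R :=
  adelicProj _ fun p => algebraMap R (AdicCompletion _ R) a ^ (p : ℕ)

/-- The `𝐩`-adic finite multiple polylogarithm `£_{𝒜̂,α}(a₁, …, a_r; k₁, …, k_r)`, the class of
`(£_{<p}(a₁, …, a_r; k₁, …, k_r))_p`. The integers `1, …, p - 1` are invertible in
`lim R/pⁿR`. -/
noncomputable def fmpl (t : List (R × ℕ)) : AHat N α R :=
  adelicProj _ fun p =>
    mplTrunc (p : ℕ) (t.map fun c => (algebraMap R (AdicCompletion _ R) c.1, c.2))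

/-- The `ℚ`-linear extension of `£_{𝒜̂,α}` to formal tuples, the symbol `a : A` standing for the
element `val a` of `R`. -/
noncomputable def fmplLin {A : Type*} (val : A → R) : Tuples A →ₗ[ℚ] AHat N α R :=
  Finsupp.linearCombination ℚ fun t => fmpl N α (t.map fun c => (val c.1, (c.2 : ℕ)))

end FMPL

/-! ### The variables -/

/-- `ℤ[x₁, …, x_r, y₁, y₁⁻¹, y₂, …, y_{s+1}]`. -/
abbrev LaurentRing (r s : ℕ) :=
  Localization.Away (MvPolynomial.X (Sum.inr 0) : MvPolynomial (Fin r ⊕ Fin (s + 1)) ℤ)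

/-- The variable `x_i`. -/
noncomputable def xv {r s : ℕ} (i : Fin r) : LaurentRing r s :=
  algebraMap (MvPolynomial (Fin r ⊕ Fin (s + 1)) ℤ) _ (MvPolynomial.X (Sum.inl i))

/-- The variable `y_j`. -/
noncomputable def yv {r s : ℕ} (j : Fin (s + 1)) : LaurentRing r s :=
  algebraMap (MvPolynomial (Fin r ⊕ Fin (s + 1)) ℤ) _ (MvPolynomial.X (Sum.inr j))

/-- The element `y₁⁻¹`. -/
noncomputable def y1inv {r s : ℕ} : LaurentRing r s :=
  IsLocalization.Away.invSelf
    (MvPolynomial.X (Sum.inr 0) : MvPolynomial (Fin r ⊕ Fin (s + 1)) ℤ)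

/-- The symbols `1` (that is `none`), `x_i` and `y_j`. -/
abbrev Symb (r s : ℕ) := Option (Fin r ⊕ Fin (s + 1))

/-- The element of the ring denoted by a symbol. -/
noncomputable def symbVal {r s : ℕ} : Symb r s → LaurentRing r s
  | none => 1
  | some (Sum.inl i) => xv i
  | some (Sum.inr j) => yv j

/-- The tuple `(x₁, …, x_r; k₁, …, k_r)`. -/
noncomputable def xTuple {r s : ℕ} (k : Fin r → ℕ+) : Tuples (Symb r s) :=
  Finsupp.single (List.ofFn fun i => (some (Sum.inl i), k i)) 1

/-- The tuple `(y₁, …, y_{s+1}; l₁, …, l_{s+1})`. -/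
noncomputable def yTuple {r s : ℕ} (l : Fin (s + 1) → ℕ+) : Tuples (Symb r s) :=
  Finsupp.single (List.ofFn fun j => (some (Sum.inr j), l j)) 1

/-- The tuple with first row `x₁/y₁, …, x_r/y₁, 1/y₁, y_{s+1}/y₁, …, y₂/y₁` and second row
`k₁, …, k_r, l_{s+1} + f_{s+1}, …, l₁ + f₁`. -/
noncomputable def reversedTuple {r s : ℕ} (k : Fin r → ℕ+) (l : Fin (s + 1) → ℕ+)
    (f : Fin (s + 1) → ℕ) : List (LaurentRing r s × ℕ) :=
  List.zip
    ((List.ofFn fun i => xv i * y1inv) ++ y1inv ::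
      (List.ofFn fun j : Fin s => yv j.succ * y1inv).reverse)
    ((List.ofFn fun i => (k i : ℕ)) ++ (List.ofFn fun j => (l j : ℕ) + f j).reverse)

end PShuffle

open PShuffle

/-!
The sum `£_{<p}(t)` is the coefficient of `X ^ p` in the product of a geometric series and a power
series attached to `t`. The series of the words ending in `e_z` are obtained, modulo `X ^ p`, by
multiplying by a kernel depending on `z` and inverting `X d/dX`; by the Leibniz rule they therefore
carry the shuffle product to the product of power series. In the coefficient of `X ^ p` of a
product, the weight `n ↦ 1 / n ^ l` of one factor can be moved to the other one as
`n ↦ 1 / (p - n) ^ l`. Moving the weights of `y_s, …, y₁` in turn reverses the tuple, the binomial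
series expands `1 / (p - n) ^ l` in powers of `p`, and the substitution `X ↦ X / y₁` produces the
factor `y₁ ^ p`. Modulo `p ^ n` only the finitely many terms with all `f_i < n` survive.
-/

namespace PShuffle

open PowerSeries Finset

section GeneratingSeries

variable {S : Type*} [CommRing S]

/-- The series `∑_{n ≥ 1} aⁿ Xⁿ`; multiplication by it appends a summation variable. -/
noncomputable def geomTail (a : S) : S⟦X⟧ := PowerSeries.mk (a ^ ·) - 1

theorem coeff_geomTail_mul (a : S) (F : S⟦X⟧) (n : ℕ) :
    coeff n (geomTail a * F) = ∑ m ∈ range n, a ^ (n - m) * coeff m F := by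
  rw [geomTail, mul_comm, mul_sub, mul_one, map_sub, coeff_mul,
    Nat.sum_antidiagonal_eq_sum_range_succ_mk, sum_range_succ]
  simp [mul_comm]

theorem coeff_geomTail_mul_eq_of_X_pow_dvd_sub (a : S) {M : ℕ} {F G : S⟦X⟧} (h : X ^ M ∣ F - G) :
    coeff M (geomTail a * F) = coeff M (geomTail a * G) := by
  simp only [coeff_geomTail_mul]
  refine sum_congr rfl fun m hm => ?_
  rw [sub_eq_zero.1 ((map_sub _ F G).symm.trans (X_pow_dvd_iff.1 h m (mem_range.1 hm)))]

theorem constantCoeff_geomTail (a : S) : constantCoeff (geomTail a) = 0 := by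
  rw [geomTail, map_sub, constantCoeff_mk, map_one, pow_zero, sub_self]

/-- The coefficientwise product of a sequence and a power series. -/
noncomputable def weight : (ℕ → S) →ₗ[S] S⟦X⟧ →ₗ[S] S⟦X⟧ :=
  LinearMap.mk₂ S (fun w F => PowerSeries.mk fun n => w n * coeff n F)
    (fun v w F => by ext n; simp [add_mul])
    (fun c w F => by ext n; simp [mul_assoc])
    (fun w F G => by ext n; simp [mul_add])
    (fun c w F => by ext n; simp [mul_left_comm])

@[simp]
theorem coeff_weight (w : ℕ → S) (F : S⟦X⟧) (n : ℕ) : coeff n (weight w F) = w n * coeff n F :=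
  coeff_mk n fun n => w n * coeff n F

theorem weight_weight (v w : ℕ → S) (F : S⟦X⟧) : weight v (weight w F) = weight (v * w) F := by
  ext n
  simp [mul_assoc]

theorem coeff_mul_weight (M : ℕ) (w : ℕ → S) (F H : S⟦X⟧) :
    coeff M (F * weight w H) = coeff M (weight (fun n => w (M - n)) F * H) := by
  simp only [coeff_mul, coeff_weight]
  refine sum_congr rfl fun x hx => ?_
  rw [← mem_antidiagonal.1 hx, Nat.add_sub_cancel_left]
  ring

/-- Multiplies `F` by the generating series of a multiple polylogarithm: for `w n = 1 / n` the
`n`-th coefficient of `appendSeries w 1 t` collects the terms whose largest summation variable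
is `n`. -/
noncomputable def appendSeries (w : ℕ → S) : S⟦X⟧ → List (S × ℕ) → S⟦X⟧
  | F, [] => F
  | F, (a, k) :: t => appendSeries w (weight (w ^ k) (geomTail a * F)) t

theorem appendSeries_append (w : ℕ → S) (F : S⟦X⟧) (t t' : List (S × ℕ)) :
    appendSeries w F (t ++ t') = appendSeries w (appendSeries w F t) t' := by
  induction t generalizing F with
  | nil => rfl
  | cons _ _ ih => exact ih _

variable (S) in
/-- `1 / n` for `0 < n < M`, and `0` otherwise, as `Ring.inverse 0 = 0`. -/
noncomputable def truncInv (M n : ℕ) : S := if n < M then Ring.inverse (n : S) else 0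

theorem truncInv_zero (M : ℕ) : truncInv S M 0 = 0 := by simp [truncInv]

theorem truncInv_of_le {M n : ℕ} (h : M ≤ n) : truncInv S M n = 0 := if_neg h.not_gt

theorem natCast_mul_truncInv {M n : ℕ} (h : n < M) (hn : IsUnit (n : S)) :
    (n : S) * truncInv S M n = 1 := by
  rw [truncInv, if_pos h, Ring.mul_inverse_cancel _ hn]

theorem inverse_natCast_pow {M n : ℕ} (h : n < M) (k : ℕ) :
    Ring.inverse ((n : S) ^ k) = truncInv S M n ^ k := by
  rw [truncInv, if_pos h, Ring.inverse_pow]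

theorem coeff_geomTail_one_mul_appendSeries (M : ℕ) (F : S⟦X⟧) (t : List (S × ℕ)) :
    coeff M (geomTail 1 * appendSeries (truncInv S M) F t) =
      ∑ m ∈ range M, coeff m F * mplFrom M m t := by
  induction t generalizing F with
  | nil => simp [appendSeries, mplFrom, coeff_geomTail_mul]
  | cons d t ih =>
    obtain ⟨a, k⟩ := d
    simp only [appendSeries, ih, mplFrom, coeff_weight, coeff_geomTail_mul, mul_sum, sum_mul]
    rw [sum_comm' (t' := range M) (s' := fun m => Ioo m M)
      (by simp only [mem_range, mem_Ioo]; omega)]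
    refine sum_congr rfl fun m _ => sum_congr rfl fun n hn => ?_
    rw [inverse_natCast_pow (mem_Ioo.1 hn).2, Pi.pow_apply]
    ring

theorem mplTrunc_eq_coeff {M : ℕ} (hM : 0 < M) (t : List (S × ℕ)) :
    mplTrunc M t = coeff M (geomTail 1 * appendSeries (truncInv S M) 1 t) := by
  rw [coeff_geomTail_one_mul_appendSeries, sum_eq_single_of_mem 0 (mem_range.2 hM)]
  · simp [mplTrunc]
  · intro m _ hm
    simp [coeff_one, hm]

/-- The series by which the letter `e_z` multiplies before the division of the `n`-th
coefficient by `n`. -/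
noncomputable def letterKernel {A : Type*} (val : A → S) : Option A → S⟦X⟧
  | none => 1
  | some a => geomTail (val a)

/-- The generating series of a word, which is written from its last letter to its first one. -/
noncomputable def wordSeries {A : Type*} (M : ℕ) (val : A → S) : List (Option A) → S⟦X⟧
  | [] => 1
  | z :: u => weight (truncInv S M) (letterKernel val z * wordSeries M val u)

theorem constantCoeff_wordSeries_cons {A : Type*} (M : ℕ) (val : A → S) (z : Option A)
    (u : List (Option A)) : constantCoeff (wordSeries M val (z :: u)) = 0 := by
  rw [← coeff_zero_eq_constantCoeff_apply, wordSeries, coeff_weight, truncInv_zero, zero_mul]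

theorem wordSeries_replicate_none_append {A : Type*} (M : ℕ) (val : A → S) (a : A) (j : ℕ)
    (u : List (Option A)) :
    wordSeries M val (List.replicate j none ++ some a :: u) =
      weight (truncInv S M ^ (j + 1)) (geomTail (val a) * wordSeries M val u) := by
  induction j with
  | zero => simp [wordSeries, letterKernel]
  | succ j ih =>
    rw [List.replicate_succ, List.cons_append, wordSeries, ih, letterKernel, one_mul,
      weight_weight, ← pow_succ']

theorem wordSeries_reverse_encode {A : Type*} (M : ℕ) (val : A → S) (t : List (A × ℕ+)) :
    wordSeries M val (encode t).reverse =
      appendSeries (truncInv S M) 1 (t.map fun d => (val d.1, (d.2 : ℕ))) := by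
  induction t using List.reverseRecOn with
  | nil => simp [encode, wordSeries, appendSeries]
  | append_singleton t d ih =>
    have encode_append : (encode (t ++ [d])).reverse =
        List.replicate ((d.2 : ℕ) - 1) none ++ some d.1 :: (encode t).reverse := by
      simp [encode]
    rw [encode_append, wordSeries_replicate_none_append, ih, Nat.sub_add_cancel d.2.pos,
      List.map_append, appendSeries_append]
    rfl

end GeneratingSeries

section ShuffleWords

/-- The words, with multiplicity, whose sum is the shuffle product of two words that are written
from their last letters to their first ones. -/
def shuffleWords {B : Type*} : List B → List B → List (List B)
  | [], v => [v]
  | z :: u, [] => [z :: u]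
  | z :: u, z' :: v =>
      (shuffleWords (z :: u) v).map (z' :: ·) ++ (shuffleWords u (z' :: v)).map (z :: ·)
termination_by u v => u.length + v.length

theorem sum_map_wordBasis_reverse_mul_e {A : Type*} (x : Option A) (l : List (List (Option A))) :
    (l.map fun w => wordBasis A w.reverse).sum * e x =
      ((l.map (x :: ·)).map fun w => wordBasis A w.reverse).sum := by
  rw [← List.sum_map_mul_right, List.map_map]
  simp [wordBasis_apply, Function.comp_def]

theorem shuffleRev_eq_sum {A : Type*} : ∀ u v : List (Option A),
    shuffleRev u v = ((shuffleWords u v).map fun w => wordBasis A w.reverse).sum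
  | [], v => by simp [shuffleRev, shuffleWords, wordBasis_apply]
  | z :: u, [] => by simp [shuffleRev, shuffleWords, wordBasis_apply]
  | z :: u, z' :: v => by
    rw [shuffleRev, shuffleWords, shuffleRev_eq_sum (z :: u) v, shuffleRev_eq_sum u (z' :: v),
      List.map_append, List.sum_append, sum_map_wordBasis_reverse_mul_e,
      sum_map_wordBasis_reverse_mul_e]
termination_by u v => u.length + v.length

theorem tupleShuffle_single {A : Type*} (t t' : List (A × ℕ+)) :
    tupleShuffle (Finsupp.single t 1) (Finsupp.single t' 1) =
      ((shuffleWords (encode t).reverse (encode t').reverse).map fun w =>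
        Finsupp.single (decodeAux w.reverse).2 1).sum := by
  rw [tupleShuffle, W_single, W_single, shuffle_basis, shuffleRev_eq_sum, map_list_sum,
    List.map_map]
  simp [WInv, Function.comp_def]

theorem getLast?_of_mem_shuffleWords {B : Type*} : ∀ {u v w : List B}, w ∈ shuffleWords u v →
    w.getLast? = u.getLast? ∨ w.getLast? = v.getLast?
  | [], v, w, hw => by simp_all [shuffleWords]
  | z :: u, [], w, hw => by simp_all [shuffleWords]
  | z :: u, z' :: v, w, hw => by
    rw [shuffleWords, List.mem_append, List.mem_map, List.mem_map] at hw
    rcases hw with ⟨w, hw, rfl⟩ | ⟨w, hw, rfl⟩ <;>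
      have := getLast?_of_mem_shuffleWords hw <;> simp only [List.getLast?_cons] at this ⊢
    · grind
    · grind
termination_by u v => u.length + v.length

theorem getLast?_encode_reverse_ne {A : Type*} (t : List (A × ℕ+)) :
    (encode t).reverse.getLast? ≠ some none := by
  rw [List.getLast?_reverse]
  exact encode_head t

end ShuffleWords

section ShuffleSeries

variable {S : Type*} [CommRing S]

variable (S) in
/-- The Euler derivation `X d/dX`, which multiplies the `n`-th coefficient by `n`. -/
noncomputable def euler : Derivation S S⟦X⟧ S⟦X⟧ := (X : S⟦X⟧) • PowerSeries.derivative S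

theorem coeff_euler (F : S⟦X⟧) (n : ℕ) : coeff n (euler S F) = n * coeff n F := by
  rw [euler, Derivation.smul_apply, smul_eq_mul]
  cases n with
  | zero => simp
  | succ n => simp [coeff_succ_X_mul, coeff_derivative, mul_comm]

variable {M : ℕ} (hM : ∀ n : ℕ, 0 < n → n < M → IsUnit (n : S))
include hM

theorem X_pow_dvd_of_X_pow_dvd_euler {F : S⟦X⟧} (h0 : constantCoeff F = 0)
    (h : X ^ M ∣ euler S F) : X ^ M ∣ F := by
  rw [X_pow_dvd_iff] at h ⊢
  intro n hn
  rcases n.eq_zero_or_pos with rfl | hn0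
  · rwa [coeff_zero_eq_constantCoeff_apply]
  · exact (hM n hn0 hn).mul_right_eq_zero.1 (coeff_euler F n ▸ h n hn)

theorem X_pow_dvd_euler_weight_truncInv {F : S⟦X⟧} (h0 : constantCoeff F = 0) :
    X ^ M ∣ euler S (weight (truncInv S M) F) - F := by
  rw [X_pow_dvd_iff]
  intro n hn
  rw [map_sub, coeff_euler, coeff_weight]
  rcases n.eq_zero_or_pos with rfl | hn0
  · simp [h0]
  · rw [← mul_assoc, natCast_mul_truncInv hn (hM n hn0 hn), one_mul, sub_self]

variable {A : Type*} (val : A → S)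

theorem X_pow_dvd_euler_wordSeries_cons {z : Option A} {u : List (Option A)}
    (hz : (z :: u).getLast? ≠ some none) :
    X ^ M ∣ euler S (wordSeries M val (z :: u)) - letterKernel val z * wordSeries M val u := by
  refine X_pow_dvd_euler_weight_truncInv hM ?_
  rw [map_mul]
  match z, u with
  | some a, u => rw [letterKernel, constantCoeff_geomTail, zero_mul]
  | none, x :: u => rw [constantCoeff_wordSeries_cons, mul_zero]
  | none, [] => simp at hz

theorem X_pow_dvd_euler_sum_wordSeries_map_cons {z : Option A} {l : List (List (Option A))}
    (hl : ∀ w ∈ l, (z :: w).getLast? ≠ some none) :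
    X ^ M ∣ euler S ((l.map (z :: ·)).map (wordSeries M val)).sum -
      letterKernel val z * (l.map (wordSeries M val)).sum := by
  induction l with
  | nil => simp
  | cons w l ih =>
    rw [List.forall_mem_cons] at hl
    simp only [List.map_cons, List.sum_cons, map_add, mul_add, add_sub_add_comm]
    exact dvd_add (X_pow_dvd_euler_wordSeries_cons hM val hl.1) (ih hl.2)

omit hM in
theorem constantCoeff_sum_wordSeries_shuffleWords_cons (z z' : Option A) (u v : List (Option A)) :
    constantCoeff ((shuffleWords (z :: u) (z' :: v)).map (wordSeries M val)).sum = 0 := by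
  rw [shuffleWords, map_list_sum]
  simp [Function.comp_def, constantCoeff_wordSeries_cons]

/-- The Euler derivation strips a word of its last letter, so by the Leibniz rule products of word
series satisfy the recursion that defines the shuffle product. -/
theorem X_pow_dvd_sum_wordSeries_shuffleWords_sub_mul : ∀ {u v : List (Option A)},
    u.getLast? ≠ some none → v.getLast? ≠ some none →
    X ^ M ∣ ((shuffleWords u v).map (wordSeries M val)).sum -
      wordSeries M val u * wordSeries M val v
  | [], v, _, _ => by simp [shuffleWords, wordSeries]
  | z :: u, [], _, _ => by simp [shuffleWords, wordSeries]
  | z :: u, z' :: v, hu, hv => by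
    have getLast?_ne {w} (hw : w ∈ shuffleWords (z :: u) (z' :: v)) : w.getLast? ≠ some none := by
      rcases getLast?_of_mem_shuffleWords hw with h | h <;> rwa [h]
    have hleft := X_pow_dvd_sum_wordSeries_shuffleWords_sub_mul (u := z :: u) (v := v) hu
      fun h => hv (by simp [List.getLast?_cons, h])
    have hright := X_pow_dvd_sum_wordSeries_shuffleWords_sub_mul (u := u) (v := z' :: v)
      (fun h => hu (by simp [List.getLast?_cons, h])) hv
    have eleft := X_pow_dvd_euler_sum_wordSeries_map_cons hM val (z := z')
      (l := shuffleWords (z :: u) v) fun w hw => getLast?_ne (by simp [shuffleWords, hw])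
    have eright := X_pow_dvd_euler_sum_wordSeries_map_cons hM val (z := z)
      (l := shuffleWords u (z' :: v)) fun w hw => getLast?_ne (by simp [shuffleWords, hw])
    have eu := X_pow_dvd_euler_wordSeries_cons hM val hu
    have ev := X_pow_dvd_euler_wordSeries_cons hM val hv
    refine X_pow_dvd_of_X_pow_dvd_euler hM ?_ ?_
    · rw [map_sub, constantCoeff_sum_wordSeries_shuffleWords_cons, map_mul,
        constantCoeff_wordSeries_cons, zero_mul, sub_zero]
    · rw [shuffleWords, List.map_append, List.sum_append, map_sub, map_add, Derivation.leibniz,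
        smul_eq_mul, smul_eq_mul]
      convert ((eleft.add eright).add ((hleft.mul_left (letterKernel val z')).add
        (hright.mul_left (letterKernel val z)))).sub
        ((ev.mul_left (wordSeries M val (z :: u))).add (eu.mul_left (wordSeries M val (z' :: v))))
        using 1
      ring
termination_by u v => u.length + v.length

theorem sum_mplTrunc_shuffleWords (hM0 : 0 < M) (t t' : List (A × ℕ+)) :
    ((shuffleWords (encode t).reverse (encode t').reverse).map fun w =>
      mplTrunc M ((decodeAux w.reverse).2.map fun d => (val d.1, (d.2 : ℕ)))).sum =
    coeff M (geomTail 1 *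
      appendSeries (truncInv S M) 1 (t.map fun d => (val d.1, (d.2 : ℕ))) *
      appendSeries (truncInv S M) 1 (t'.map fun d => (val d.1, (d.2 : ℕ)))) := by
  have hu := getLast?_encode_reverse_ne t
  have hv := getLast?_encode_reverse_ne t'
  have mplTrunc_decodeAux : ∀ w ∈ shuffleWords (encode t).reverse (encode t').reverse,
      mplTrunc M ((decodeAux w.reverse).2.map fun d => (val d.1, (d.2 : ℕ))) =
        coeff M (geomTail 1 * wordSeries M val w) := by
    intro w hw
    rw [mplTrunc_eq_coeff hM0, ← wordSeries_reverse_encode, encode_decodeAux_of_head,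
      List.reverse_reverse]
    rw [List.head?_reverse]
    rcases getLast?_of_mem_shuffleWords hw with h | h <;> rwa [h]
  rw [List.map_congr_left mplTrunc_decodeAux, ← wordSeries_reverse_encode,
    ← wordSeries_reverse_encode, mul_assoc, ← coeff_geomTail_mul_eq_of_X_pow_dvd_sub 1
      (X_pow_dvd_sum_wordSeries_shuffleWords_sub_mul hM val hu hv),
    ← List.sum_map_mul_left, map_list_sum, List.map_map, Function.comp_def]

end ShuffleSeries

section Reversal

variable {S : Type*} [CommRing S]

/-- Peeling off the last entry `(u j, l j)` of the list leaves a weight on the second factor of a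
product, which is moved to the first factor at the price of reflecting it. -/
theorem coeff_geomTail_mul_mul_appendSeries_ofFn (M : ℕ) (w : ℕ → S) {s : ℕ}
    (u : Fin (s + 1) → S) (l : Fin s → ℕ) (G : S⟦X⟧) :
    coeff M (geomTail (u (Fin.last s)) * G *
      appendSeries w 1 (List.ofFn fun j => (u j.castSucc, l j))) =
    coeff M (geomTail (u 0) *
      appendSeries (fun n => w (M - n)) G (List.ofFn fun j => (u j.succ, l j)).reverse) := by
  induction s generalizing G with
  | zero => simp [appendSeries]
  | succ s ih =>
    have peel := ih (fun j => u j.castSucc) (fun j => l j.castSucc)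
      (weight ((fun n => w (M - n)) ^ l (Fin.last s)) (geomTail (u (Fin.last (s + 1))) * G))
    rw [Fin.castSucc_zero] at peel
    rw [List.ofFn_succ', List.concat_eq_append, appendSeries_append,
      List.ofFn_succ' (f := fun j => (u j.succ, l j)), List.concat_eq_append,
      List.reverse_append, List.reverse_singleton, List.singleton_append]
    simp only [appendSeries, Fin.succ_last, Fin.succ_castSucc]
    rw [← peel, coeff_mul_weight, mul_left_comm, ← mul_assoc]
    rfl

theorem rescale_weight (w : ℕ → S) (c : S) (F : S⟦X⟧) :
    rescale c (weight w F) = weight w (rescale c F) := by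
  ext n
  simp [coeff_rescale, mul_left_comm]

theorem rescale_geomTail (a c : S) : rescale c (geomTail a) = geomTail (a * c) := by
  ext n
  simp [geomTail, coeff_rescale, mul_pow, mul_comm]

theorem rescale_appendSeries (w : ℕ → S) (c : S) (F : S⟦X⟧) (t : List (S × ℕ)) :
    rescale c (appendSeries w F t) =
      appendSeries w (rescale c F) (t.map fun d => (d.1 * c, d.2)) := by
  induction t generalizing F with
  | nil => rfl
  | cons d t ih =>
    simp only [List.map_cons, appendSeries, ih, rescale_weight, map_mul, rescale_geomTail]

theorem coeff_geomTail_mul_appendSeries_one (M : ℕ) (w : ℕ → S) {a c : S} (hac : a * c = 1)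
    (t : List (S × ℕ)) :
    coeff M (geomTail a * appendSeries w 1 t) =
      a ^ M * coeff M (geomTail 1 * appendSeries w 1 (t.map fun d => (d.1 * c, d.2))) := by
  have hcM : a ^ M * c ^ M = 1 := by rw [← mul_pow, hac, one_pow]
  rw [← hac, ← rescale_geomTail, ← map_one (rescale c), ← rescale_appendSeries, ← map_mul,
    coeff_rescale, ← mul_assoc, hcM, one_mul, map_one]

end Reversal

section Expansion

variable {S : Type*} [CommRing S]

theorem pow_dvd_one_sub_pow_mul_sum_choose_sub_one (t : S) (l n : ℕ) :
    t ^ n ∣ (1 - t) ^ (l + 1) * ∑ f ∈ range n, ((l + f).choose l : S) * t ^ f - 1 := by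
  set F : S⟦X⟧ := PowerSeries.mk fun f => ((l + f).choose l : S) with hF
  have hseries : (X : S⟦X⟧) ^ n ∣ (1 - X) ^ (l + 1) * (trunc n F : S⟦X⟧) - 1 := by
    have hF1 : (1 - X) ^ (l + 1) * F = 1 := by
      rw [mul_comm, hF, mk_add_choose_mul_one_sub_pow_eq_one]
    have htrunc : (X : S⟦X⟧) ^ n ∣ (trunc n F : S⟦X⟧) - F :=
      X_pow_dvd_iff.2 fun m hm => by rw [map_sub, coeff_coe_trunc_of_lt hm, sub_self]
    have hdvd := htrunc.mul_left ((1 - X) ^ (l + 1))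
    rwa [mul_sub, hF1] at hdvd
  have hpoly : (Polynomial.X : Polynomial S) ^ n ∣
      (1 - Polynomial.X) ^ (l + 1) * trunc n F - 1 := by
    rw [X_pow_dvd_iff] at hseries
    rw [Polynomial.X_pow_dvd_iff]
    intro m hm
    rw [← Polynomial.coeff_coe, ← hseries m hm]
    simp
  have heval := map_dvd (Polynomial.evalRingHom t) hpoly
  simpa only [map_sub, map_mul, map_pow, map_one, Polynomial.coe_evalRingHom, Polynomial.eval,
    Polynomial.eval₂_X, eval₂_trunc_eq_sum_range, RingHom.id_apply, hF, coeff_mk] using heval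

theorem truncInv_sub_mul_one_sub {M : ℕ} (hM : ∀ i : ℕ, 0 < i → i < M → IsUnit (i : S)) (i : ℕ) :
    truncInv S M (M - i) * (1 - M * truncInv S M i) = -truncInv S M i := by
  rcases Nat.eq_zero_or_pos i with rfl | hi
  · rw [Nat.sub_zero, truncInv_of_le le_rfl, truncInv_zero, zero_mul, neg_zero]
  rcases Nat.lt_or_ge i M with hiM | hiM
  · have hu := natCast_mul_truncInv hiM (hM i hi hiM)
    have hv := natCast_mul_truncInv (Nat.sub_lt (hi.trans hiM) hi)
      (hM (M - i) (Nat.sub_pos_of_lt hiM) (Nat.sub_lt (hi.trans hiM) hi))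
    rw [Nat.cast_sub hiM.le] at hv
    linear_combination (-truncInv S M i) * hv - truncInv S M (M - i) * hu
  · rw [Nat.sub_eq_zero_of_le hiM, truncInv_of_le hiM, truncInv_zero, zero_mul, neg_zero]

/-- The binomial series, applied to `1 / (M - i) = -(1 / i) / (1 - M / i)`. -/
theorem pow_dvd_truncInv_sub_pow_sub_sum {M : ℕ}
    (hM : ∀ i : ℕ, 0 < i → i < M → IsUnit (i : S)) (n : ℕ) {l : ℕ} (hl : 0 < l) (i : ℕ) :
    (M : S) ^ n ∣ truncInv S M (M - i) ^ l - ∑ f ∈ range n,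
      ((-1) ^ l * ((l + f - 1).choose f : S) * (M : S) ^ f) * truncInv S M i ^ (l + f) := by
  obtain ⟨l, rfl⟩ := Nat.exists_eq_add_of_lt hl
  rw [zero_add]
  set u := truncInv S M i
  set v := truncInv S M (M - i)
  have reflect : v * (1 - M * u) = -u := truncInv_sub_mul_one_sub hM i
  have hsum : ∑ f ∈ range n,
      ((-1) ^ (l + 1) * ((l + 1 + f - 1).choose f : S) * (M : S) ^ f) * u ^ (l + 1 + f) =
        (-u) ^ (l + 1) * ∑ f ∈ range n, ((l + f).choose l : S) * (M * u) ^ f := by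
    rw [mul_sum]
    refine sum_congr rfl fun f _ => ?_
    rw [Nat.add_right_comm, Nat.add_sub_cancel, Nat.choose_symm_add, neg_pow u]
    ring
  rw [hsum, ← reflect, mul_pow, mul_assoc, ← dvd_neg, neg_sub, ← mul_sub_one]
  exact Dvd.dvd.mul_left ((Dvd.intro _ (mul_pow (M : S) u n).symm).trans
    (pow_dvd_one_sub_pow_mul_sum_choose_sub_one _ l n)) _

theorem C_dvd_weight_sub_weight {m : S} {v w : ℕ → S} (hvw : ∀ i, m ∣ v i - w i) {F G : S⟦X⟧}
    (hFG : C m ∣ F - G) : C m ∣ weight v F - weight w G := by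
  choose d hd using hvw
  obtain ⟨H, hH⟩ := hFG
  have hvw : v - w = m • d := funext hd
  rw [← smul_eq_C_mul] at hH
  rw [← sub_add_sub_cancel (weight v F) (weight v G), ← map_sub, hH, ← LinearMap.sub_apply,
    ← map_sub, hvw, map_smul, map_smul, LinearMap.smul_apply, ← smul_add, smul_eq_C_mul]
  exact dvd_mul_right _ _

theorem dvd_coeff_mul_sub_coeff_mul {m : S} {F G : S⟦X⟧} (h : C m ∣ F - G) (K : S⟦X⟧) (n : ℕ) :
    m ∣ coeff n (K * F) - coeff n (K * G) := by
  obtain ⟨H, hH⟩ := h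
  rw [← map_sub, ← mul_sub, hH, mul_left_comm, coeff_C_mul]
  exact dvd_mul_right _ _

theorem C_dvd_appendSeries_sub_sum {m : S} {v w : ℕ → S} {n : ℕ} {c : ℕ → ℕ → S} {s : ℕ}
    (b : Fin s → S) {l : Fin s → ℕ}
    (h : ∀ j i, m ∣ v i ^ l j - ∑ f ∈ range n, c (l j) f * w i ^ (l j + f)) (G : S⟦X⟧) :
    C m ∣ appendSeries v G (List.ofFn fun j => (b j, l j)).reverse -
      ∑ f ∈ Fintype.piFinset fun _ : Fin s => range n, (∏ j, c (l j) (f j)) •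
        appendSeries w G (List.ofFn fun j => (b j, l j + f j)).reverse := by
  induction s with
  | zero => simp [appendSeries]
  | succ s ih =>
    have expand_tail := ih (fun j => b j.succ) (l := fun j => l j.succ) fun j => h j.succ
    set E := ∑ f ∈ Fintype.piFinset fun _ : Fin s => range n, (∏ j, c (l j.succ) (f j)) •
      appendSeries w G (List.ofFn fun j => (b j.succ, l j.succ + f j)).reverse with hE
    have expand_head : ∑ f ∈ Fintype.piFinset fun _ : Fin (s + 1) => range n,
        (∏ j, c (l j) (f j)) • appendSeries w G (List.ofFn fun j => (b j, l j + f j)).reverse =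
          weight (∑ f ∈ range n, c (l 0) f • w ^ (l 0 + f)) (geomTail (b 0) * E) := by
      simp only [hE, mul_sum, map_sum, map_smul, mul_smul_comm, LinearMap.sum_apply,
        LinearMap.smul_apply, smul_sum, smul_smul]
      rw [sum_comm, ← sum_product']
      refine (sum_equiv (Fin.consEquiv fun _ => ℕ) ?_ ?_).symm
      · intro x
        simp [Fin.forall_fin_succ]
      · intro x _
        simp [Fin.prod_univ_succ, List.ofFn_succ, appendSeries_append, appendSeries,
          mul_comm]
    rw [expand_head, List.ofFn_succ, List.reverse_cons, appendSeries_append]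
    refine C_dvd_weight_sub_weight (fun i => by simpa using h 0 i) ?_
    rw [← mul_sub]
    exact expand_tail.mul_left _

end Expansion

section TruncatedFormula

variable {S : Type*} [CommRing S]

/-- The tuple with first row `t, 1, y_s, …, y_1`, multiplied by `c`, and second row
`t, l_s, …, l_0`; it indexes the right-hand side of the shuffle relation. -/
def reversalTuple (c : S) (t : List (S × ℕ)) {s : ℕ} (y : Fin (s + 1) → S)
    (l : Fin (s + 1) → ℕ) : List (S × ℕ) :=
  (t ++ (List.ofFn fun j => ((Fin.snoc y 1 : Fin (s + 2) → S) j.succ, l j)).reverse).map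
    fun d => (d.1 * c, d.2)

theorem reversalTuple_map {T : Type*} [CommRing T] (φ : S →+* T) (c : S) (t : List (S × ℕ))
    {s : ℕ} (y : Fin (s + 1) → S) (l : Fin (s + 1) → ℕ) :
    (reversalTuple c t y l).map (fun d => (φ d.1, d.2)) =
      reversalTuple (φ c) (t.map fun d => (φ d.1, d.2)) (φ ∘ y) l := by
  have map_snoc : ∀ j, φ ((Fin.snoc y 1 : Fin (s + 2) → S) j) =
      (Fin.snoc (φ ∘ y) 1 : Fin (s + 2) → T) j := fun j => by
    rw [← map_one φ, ← Fin.comp_snoc, Function.comp_apply]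
  simp [reversalTuple, List.map_reverse, List.map_ofFn, Function.comp_def, map_snoc]

theorem coeff_geomTail_mul_appendSeries_eq_mplTrunc {M : ℕ} (hM0 : 0 < M) {s : ℕ}
    {y : Fin (s + 1) → S} {c : S} (hc : y 0 * c = 1) (t : List (S × ℕ)) (l : Fin (s + 1) → ℕ) :
    coeff M (geomTail (y 0) * appendSeries (truncInv S M) (appendSeries (truncInv S M) 1 t)
      (List.ofFn fun j => ((Fin.snoc y 1 : Fin (s + 2) → S) j.succ, l j)).reverse) =
    y 0 ^ M * mplTrunc M (reversalTuple c t y l) := by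
  rw [← appendSeries_append, coeff_geomTail_mul_appendSeries_one M _ hc,
    mplTrunc_eq_coeff hM0, reversalTuple]

theorem pow_dvd_sum_mplTrunc_shuffleWords_sub {M : ℕ} (hM0 : 0 < M)
    (hM : ∀ i : ℕ, 0 < i → i < M → IsUnit (i : S)) {A : Type*} (val : A → S)
    (t : List (A × ℕ+)) {s : ℕ} (y : Fin (s + 1) → A) (l : Fin (s + 1) → ℕ+) {c : S}
    (hc : val (y 0) * c = 1) (n : ℕ) :
    (M : S) ^ n ∣ ((shuffleWords (encode t).reverse
        (encode (List.ofFn fun j => (y j, l j))).reverse).map fun w =>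
          mplTrunc M ((decodeAux w.reverse).2.map fun d => (val d.1, (d.2 : ℕ)))).sum -
      (-1) ^ (∑ j, (l j : ℕ)) * val (y 0) ^ M * ∑ f ∈ Fintype.piFinset fun _ => range n,
        ((∏ j, ((l j : ℕ) + f j - 1).choose (f j) : ℕ) : S) *
          mplTrunc M (reversalTuple c (t.map fun d => (val d.1, (d.2 : ℕ))) (val ∘ y)
            fun j => l j + f j) * (M : S) ^ (∑ j, f j) := by
  set G := appendSeries (truncInv S M) 1 (t.map fun d => (val d.1, (d.2 : ℕ)))
  have reflected := coeff_geomTail_mul_mul_appendSeries_ofFn M (truncInv S M)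
    (Fin.snoc (val ∘ y) 1 : Fin (s + 2) → S) (fun j => (l j : ℕ)) G
  simp only [Fin.snoc_last, Fin.snoc_castSucc, ← Fin.castSucc_zero] at reflected
  have expanded := dvd_coeff_mul_sub_coeff_mul
    (C_dvd_appendSeries_sub_sum (m := (M : S) ^ n) (v := fun i => truncInv S M (M - i))
      (w := truncInv S M) (n := n) (l := fun j => (l j : ℕ))
      (c := fun l f => (-1) ^ l * ((l + f - 1).choose f : S) * (M : S) ^ f)
      (fun j => (Fin.snoc (val ∘ y) 1 : Fin (s + 2) → S) j.succ)
      (fun j i => pow_dvd_truncInv_sub_pow_sub_sum hM n (l j).pos i) G) (geomTail (val (y 0))) M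
  rw [sum_mplTrunc_shuffleWords hM val hM0, List.map_ofFn]
  convert expanded using 1
  refine congrArg₂ _ reflected ?_
  rw [mul_sum, mul_sum, map_sum]
  refine sum_congr rfl fun f _ => ?_
  rw [mul_smul_comm, coeff_smul, ← Function.comp_apply (f := val),
    coeff_geomTail_mul_appendSeries_eq_mplTrunc hM0 hc, prod_mul_distrib, prod_mul_distrib,
    prod_pow_eq_pow_sum, prod_pow_eq_pow_sum]
  push_cast
  simp only [Function.comp_apply]
  ring

end TruncatedFormula

section AdicCompletion

variable {R : Type*} [CommRing R]

theorem isUnit_algebraMap_adicCompletion (I : Ideal R) (x : R)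
    (h : ∀ k : ℕ, ∃ a, x * a - 1 ∈ I ^ k) : IsUnit (algebraMap R (AdicCompletion I R) x) := by
  choose a ha using h
  have cauchy : ∀ {m n : ℕ}, m ≤ n → a m ≡ a n [SMOD (I ^ m • ⊤ : Submodule R R)] := by
    intro m n hmn
    rw [SModEq.sub_mem, smul_eq_mul, Ideal.mul_top]
    convert Ideal.sub_mem _ (Ideal.mul_mem_left _ (a n) (ha m))
      (Ideal.mul_mem_left _ (a m) (Ideal.pow_le_pow_right hmn (ha n))) using 1
    ring
  refine IsUnit.of_mul_eq_one (AdicCompletion.mk I R ⟨a, cauchy⟩)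
    (AdicCompletion.ext_evalₐ fun n => ?_)
  rw [map_mul, AlgHom.commutes, map_one, Ideal.Quotient.algebraMap_eq]
  refine (congrArg _ (AdicCompletion.evalₐ_mk I n _)).trans ?_
  rw [← map_mul, ← map_one (Ideal.Quotient.mk (I ^ n)), Ideal.Quotient.eq]
  exact ha n

theorem isUnit_natCast_adicCompletion (R : Type*) [CommRing R] {m n : ℕ} (h : n.Coprime m) :
    IsUnit (n : AdicCompletion (Ideal.span {(m : R)}) R) := by
  rw [← map_natCast (algebraMap R (AdicCompletion (Ideal.span {(m : R)}) R)) n]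
  refine isUnit_algebraMap_adicCompletion _ _ fun k => ?_
  obtain ⟨a, b, bezout⟩ := (Nat.isCoprime_iff_coprime.2 (h.pow_right k)).map (Int.castRingHom R)
  simp only [eq_intCast, Int.cast_natCast, Nat.cast_pow, Int.cast_pow] at bezout
  refine ⟨a, ?_⟩
  rw [show (n : R) * a - 1 = -b * (m : R) ^ k by linear_combination bezout]
  exact Ideal.mul_mem_left _ _ (Ideal.pow_mem_pow (Ideal.mem_span_singleton_self _) k)

end AdicCompletion

section AdelicLevels

variable {ι R : Type*} [CommRing R] {σ : ι → R}

/-- The projection of the adelic ring onto `𝒜ₙ`. -/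
noncomputable def levelMap (σ : ι → R) (n : ℕ+) : Adelic σ →+* AdelicLevel σ n :=
  (Pi.evalRingHom (fun n : ℕ+ => AdelicLevel σ n) n).comp (adelicSubring σ).subtype

theorem levelMap_adelicProj_congr {n : ℕ+} {F G : ∀ i, AdicCompletion (Ideal.span {σ i}) R}
    (h : ∀ i, algebraMap R (AdicCompletion (Ideal.span {σ i}) R) (σ i) ^ (n : ℕ) ∣ F i - G i) :
    levelMap σ n (adelicProj σ F) = levelMap σ n (adelicProj σ G) := by
  refine congrArg (Ideal.Quotient.mk (finSuppIdeal σ n)) (funext fun i => ?_)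
  obtain ⟨H, hH⟩ := h i
  have generator_pow : AdicCompletion.evalₐ (Ideal.span {σ i}) n
      (algebraMap R (AdicCompletion _ R) (σ i) ^ (n : ℕ)) = 0 := by
    rw [map_pow, AlgHom.commutes, Ideal.Quotient.algebraMap_eq, ← map_pow,
      Ideal.Quotient.eq_zero_iff_mem]
    exact Ideal.pow_mem_pow (Ideal.mem_span_singleton_self _) n
  change AdicCompletion.evalₐ _ _ (F i) = AdicCompletion.evalₐ _ _ (G i)
  rw [← sub_eq_zero, ← map_sub, hH, map_mul, generator_pow, zero_mul]

theorem hasSum_of_levelMap {β : Type*} (g : β → Adelic σ) (z : Adelic σ)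
    (h : ∀ n : ℕ+, ∃ I : Finset β, (∀ b ∉ I, levelMap σ n (g b) = 0) ∧
      levelMap σ n (∑ b ∈ I, g b) = levelMap σ n z) : HasSum g z := by
  let _ : ∀ n : ℕ+, TopologicalSpace (AdelicLevel σ n) := fun _ => ⊥
  have _ : ∀ n : ℕ+, DiscreteTopology (AdelicLevel σ n) := fun _ => ⟨rfl⟩
  have inducing : Topology.IsInducing
      (fun f : Adelic σ => (f.1 : ∀ n : ℕ+, AdelicLevel σ n)) := ⟨rfl⟩
  rw [HasSum, SummationFilter.unconditional_filter, inducing.tendsto_nhds_iff, tendsto_pi_nhds]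
  intro n
  obtain ⟨I, outside, inside⟩ := h n
  refine tendsto_nhds_of_eventually_eq ?_
  filter_upwards [Filter.eventually_ge_atTop I] with J hJ
  change levelMap σ n (∑ b ∈ J, g b) = levelMap σ n z
  rw [← inside, map_sum, map_sum]
  exact (sum_subset hJ fun b _ hb => outside b hb).symm

instance : T2Space (Adelic σ) := by
  let _ : ∀ n : ℕ+, TopologicalSpace (AdelicLevel σ n) := fun _ => ⊥
  have _ : ∀ n : ℕ+, DiscreteTopology (AdelicLevel σ n) := fun _ => ⟨rfl⟩
  have embedding : Topology.IsEmbedding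
      (fun f : Adelic σ => (f.1 : ∀ n : ℕ+, AdelicLevel σ n)) :=
    ⟨⟨rfl⟩, Subtype.val_injective⟩
  exact embedding.t2Space

end AdelicLevels

section FiniteMultiplePolylogarithms

variable (N : ℕ) (α : ZMod N) {R : Type*} [CommRing R]

theorem levelMap_bigP_pow {n : ℕ+} {m : ℕ} (h : n ≤ m) : levelMap _ n (bigP N α R ^ m) = 0 := by
  rw [bigP, ← map_pow, ← map_zero (levelMap _ n), ← map_zero (adelicProj _)]
  refine levelMap_adelicProj_congr fun p => ?_
  rw [Pi.zero_apply, sub_zero, Pi.pow_apply, map_natCast]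
  exact pow_dvd_pow _ h

theorem powP_mul_powP {a b : R} (h : a * b = 1) : powP N α a * powP N α b = 1 := by
  rw [powP, powP, ← map_mul, ← map_one (adelicProj _)]
  congr 1
  funext p
  rw [Pi.mul_apply, ← mul_pow, ← map_mul, h, map_one, one_pow, Pi.one_apply]

theorem fmplLin_tupleShuffle_single {A : Type*} (val : A → R) (t t' : List (A × ℕ+)) :
    fmplLin N α val (tupleShuffle (Finsupp.single t 1) (Finsupp.single t' 1)) =
      ((shuffleWords (encode t).reverse (encode t').reverse).map fun w =>
        fmpl N α ((decodeAux w.reverse).2.map fun d => (val d.1, (d.2 : ℕ)))).sum := by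
  simp only [tupleShuffle_single, map_list_sum, List.map_map, Function.comp_def, fmplLin,
    Finsupp.linearCombination_single, one_smul]

theorem levelMap_fmplLin_tupleShuffle (n : ℕ+) {A : Type*} (val : A → R) (t : List (A × ℕ+))
    {s : ℕ} (y : Fin (s + 1) → A) (l : Fin (s + 1) → ℕ+) {c : R} (hc : val (y 0) * c = 1) :
    levelMap _ n (fmplLin N α val (tupleShuffle (Finsupp.single t 1)
      (Finsupp.single (List.ofFn fun j => (y j, l j)) 1))) =
    levelMap _ n ((-1) ^ (∑ j, (l j : ℕ)) * powP N α (val (y 0)) *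
      ∑ f ∈ Fintype.piFinset fun _ => range n,
        ((∏ j, ((l j : ℕ) + f j - 1).choose (f j) : ℕ) : AHat N α R) *
          fmpl N α (reversalTuple c (t.map fun d => (val d.1, (d.2 : ℕ))) (val ∘ y)
            fun j => l j + f j) * bigP N α R ^ (∑ j, f j)) := by
  rw [fmplLin_tupleShuffle_single]
  simp only [fmpl, powP, bigP]
  rw [← map_one (adelicProj fun p : PrimesMod N α => ((p : ℕ) : R))]
  simp only [← map_neg, ← map_pow, ← map_mul,
    ← map_natCast (adelicProj fun p : PrimesMod N α => ((p : ℕ) : R)), ← map_sum]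
  rw [← Function.comp_def (adelicProj fun p : PrimesMod N α => ((p : ℕ) : R)),
    ← List.map_map, ← map_list_sum]
  refine levelMap_adelicProj_congr fun p => ?_
  have truncated := pow_dvd_sum_mplTrunc_shuffleWords_sub p.2.1.pos
    (fun i h0 hi => isUnit_natCast_adicCompletion R
      (Nat.coprime_of_lt_prime h0.ne' hi p.2.1).symm)
    (algebraMap R (AdicCompletion (Ideal.span {((p : ℕ) : R)}) R) ∘ val) t y l
    (c := algebraMap R _ c) (by rw [Function.comp_apply, ← map_mul, hc, map_one]) n
  rw [map_natCast]
  convert truncated using 1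
  simp only [reversalTuple_map, List.map_map, Function.comp_def, map_pow, Pi.mul_apply,
    Pi.pow_apply, Pi.neg_apply, Pi.one_apply, Pi.natCast_apply, Finset.sum_apply, Pi.list_sum_apply]

theorem hasSum_fmpl_reversalTuple {A : Type*} (val : A → R) (t : List (A × ℕ+))
    {s : ℕ} (y : Fin (s + 1) → A) (l : Fin (s + 1) → ℕ+) {c : R} (hc : val (y 0) * c = 1) :
    HasSum (fun f : Fin (s + 1) → ℕ =>
      ((∏ j, ((l j : ℕ) + f j - 1).choose (f j) : ℕ) : AHat N α R) *
        fmpl N α (reversalTuple c (t.map fun d => (val d.1, (d.2 : ℕ))) (val ∘ y)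
          fun j => l j + f j) * bigP N α R ^ (∑ j, f j))
    ((-1) ^ (∑ j, (l j : ℕ)) * powP N α c *
      fmplLin N α val (tupleShuffle (Finsupp.single t 1)
        (Finsupp.single (List.ofFn fun j => (y j, l j)) 1))) := by
  refine hasSum_of_levelMap _ _ fun n =>
    ⟨Fintype.piFinset fun _ => range n, fun f hf => ?_, ?_⟩
  · obtain ⟨j, hj⟩ : ∃ j, n ≤ f j := by simpa using hf
    rw [map_mul, levelMap_bigP_pow N α
      (hj.trans (single_le_sum_of_canonicallyOrdered (mem_univ j))), mul_zero]
  · rw [map_mul _ _ (fmplLin N α val _), levelMap_fmplLin_tupleShuffle N α n val t y l hc,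
      ← map_mul, ← mul_assoc, mul_mul_mul_comm, ← mul_pow, neg_one_mul, neg_neg, one_pow,
      one_mul, mul_comm (powP N α c), powP_mul_powP N α hc, one_mul]

end FiniteMultiplePolylogarithms

section Variables

variable {r s : ℕ}

theorem yv_mul_y1inv : (yv 0 : LaurentRing r s) * y1inv = 1 :=
  IsLocalization.Away.mul_invSelf _

theorem zip_ofFn {β γ : Type*} {m : ℕ} (a : Fin m → β) (b : Fin m → γ) :
    List.zip (List.ofFn a) (List.ofFn b) = List.ofFn fun i => (a i, b i) :=
  List.ext_getElem (by simp) fun i _ _ => by simp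

theorem reversedTuple_eq_reversalTuple (k : Fin r → ℕ+) (l : Fin (s + 1) → ℕ+)
    (f : Fin (s + 1) → ℕ) :
    reversedTuple k l f = reversalTuple y1inv
      ((List.ofFn fun i => (some (Sum.inl i), k i)).map fun d => (symbVal d.1, (d.2 : ℕ)))
      (symbVal ∘ fun j => some (Sum.inr j)) fun j => l j + f j := by
  change _ = reversalTuple _ _ yv _
  have first_row : y1inv ::
      (List.ofFn fun j : Fin s => (yv j.succ * y1inv : LaurentRing r s)).reverse =
      (List.ofFn fun j : Fin (s + 1) =>
        (Fin.snoc yv 1 : Fin (s + 2) → LaurentRing r s) j.succ * y1inv).reverse := by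
    rw [List.ofFn_succ', List.concat_eq_append, List.reverse_append]
    simp [← Fin.castSucc_succ, Fin.succ_last]
  rw [reversedTuple, first_row, List.zip_append (by simp), zip_ofFn, List.zip,
    ← List.reverse_zipWith (by simp), ← List.zip, zip_ofFn, reversalTuple]
  simp [List.map_ofFn, Function.comp_def, List.map_reverse, symbVal]

end Variables

end PShuffle

theorem mainTheorem1_general {R A : Type*} [CommRing R] (N : ℕ) (α : ZMod N) (val : A → R)
    (t : List (A × ℕ+)) {s : ℕ} (y : Fin (s + 1) → A) (l : Fin (s + 1) → ℕ+) {c : R}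
    (hc : val (y 0) * c = 1) :
    Summable (fun f : Fin (s + 1) → ℕ =>
      ((∏ j, ((l j : ℕ) + f j - 1).choose (f j) : ℕ) : AHat N α R) *
        fmpl N α (reversalTuple c (t.map fun d => (val d.1, (d.2 : ℕ))) (val ∘ y)
          fun j => l j + f j) * bigP N α R ^ (∑ j, f j)) ∧
    fmplLin N α val (tupleShuffle (Finsupp.single t 1)
        (Finsupp.single (List.ofFn fun j => (y j, l j)) 1)) =
      (-1) ^ (∑ j, (l j : ℕ)) * powP N α (val (y 0)) *
        ∑' f : Fin (s + 1) → ℕ,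
          ((∏ j, ((l j : ℕ) + f j - 1).choose (f j) : ℕ) : AHat N α R) *
            fmpl N α (reversalTuple c (t.map fun d => (val d.1, (d.2 : ℕ))) (val ∘ y)
              fun j => l j + f j) * bigP N α R ^ (∑ j, f j) := by
  have expansion := hasSum_fmpl_reversalTuple N α val t y l hc
  refine ⟨expansion.summable, ?_⟩
  rw [expansion.tsum_eq, ← mul_assoc, mul_mul_mul_comm, ← mul_pow, neg_one_mul, neg_neg, one_pow,
    one_mul, powP_mul_powP N α hc, one_mul]

theorem mainTheorem1 (N : ℕ) [NeZero N] (α : ZMod N) (r s : ℕ)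
    (k : Fin r → ℕ+) (l : Fin (s + 1) → ℕ+) :
    Summable (fun f : Fin (s + 1) → ℕ =>
      ((∏ j, ((l j : ℕ) + f j - 1).choose (f j) : ℕ) : AHat N α (LaurentRing r s)) *
        fmpl N α (reversedTuple k l f) * bigP N α (LaurentRing r s) ^ (∑ j, f j)) ∧
    fmplLin N α symbVal (tupleShuffle (xTuple k) (yTuple l)) =
      (-1) ^ (∑ j, (l j : ℕ)) * powP N α (yv (r := r) (s := s) 0) *
        ∑' f : Fin (s + 1) → ℕ,
          ((∏ j, ((l j : ℕ) + f j - 1).choose (f j) : ℕ) : AHat N α (LaurentRing r s)) *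
            fmpl N α (reversedTuple k l f) * bigP N α (LaurentRing r s) ^ (∑ j, f j) := by
  simp only [reversedTuple_eq_reversalTuple]
  exact mainTheorem1_general N α symbVal
    (List.ofFn fun i => (some (Sum.inl i), k i)) (fun j => some (Sum.inr j)) l yv_mul_y1inv
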